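/- **Setting.** A unitary braided fusion category is given by its skeletal data: a finite set of anyon labels $a,b,c,\dots$ with vacuum $1$, orthonormal bases $|a,b;c;\mu\rangle$ of the fusion spaces, and unitary $F$- and $R$-symbols satisfying the triangle, pentagon and hexagon equations and rigidity. A super-modular category $\mathcal C$ is a unitary braided fusion category whose only non-trivial transparent particle is a fermion $\psi$ ($\psi\times\psi=1$, $\theta_\psi=-1$). A spin modular category is a unitary modular tensor category with a chosen such fermion $\psi$. A minimal modular extension $\check{\mathcal C}$ of $\mathcal C$ is a spin modular category that contains $\mathcal C$ as the full braided subcategory of all particles braiding trivially with $\psi$, the fermion of $\check{\mathcal C}$ being that of $\mathcal C$. An autoequivalence $\rho$ of such a category (unitary or anti-unitary) is a permutation $a\mapsto{}^\rho a$ of the labels together with unitary matrices $U$ such that the linear, respectively anti-linear, map $\rho|a,b;c;\mu\rangle=\sum_\nu U({}^\rho a,{}^\rho b;{}^\rho c)_{\mu\nu}|{}^\rho a,{}^\rho b;{}^\rho c;\nu\rangle$ preserves, respectively complex conjugates, the $F$- and $R$-symbols, normalized by $U(1,a;a)=U(a,1;a)=1$. $\mathrm{Aut}_{LR}$ is the group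 of autoequivalences with $\rho|\psi,\psi;1\rangle=|\psi,\psi;1\rangle$, modulo the locality-respecting natural isomorphisms $|a,b;c;\mu\rangle\mapsto\frac{\gamma_a\gamma_b}{\gamma_c}|a,b;c;\mu\rangle$ with $\gamma_a\in \mathrm U(1)$, $\gamma_\psi=1$. Restriction to $\mathcal C$ defines a homomorphism $r:\mathrm{Aut}_{LR}(\check{\mathcal C})\to\mathrm{Aut}_{LR}(\mathcal C)$. **Theorem.** Let $\check{\mathcal C}$ be a minimal modular extension of a super-modular category $\mathcal C$, let $G_b$ be a group and $[\rho]:G_b\to\mathrm{Aut}_{LR}(\mathcal C)$ a homomorphism such that every $[\rho_g]$ lies in the image of $r$, and assume that $\ker r$ is Abelian. Let $g\in G_b$ act on $\ker r$ by ${}^g k=\check\rho\,k\,\check\rho^{-1}$ for any $\check\rho\in\mathrm{Aut}_{LR}(\check{\mathcal C})$ with $r(\check\rho)=[\rho_g]$ (the choice does not matter). Then: 1. For every choice of lifts $\check\rho_g$ with $r(\check\rho_g)=[\rho_g]$, $g\in G_b$, the formula $o_2(g,h)^{-1}=\check\rho_g\check\rho_h\check\rho_{gh}^{-1}$ defines a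 2-cocycle $o_2$ on $G_b$ with values in $\ker r$, and its class $[o_2]\in H^2(G_b,\ker r)$ does not depend on the choice of lifts. 2. The lifts can be chosen such that $g\mapsto\check\rho_g$ is a homomorphism $G_b\to\mathrm{Aut}_{LR}(\check{\mathcal C})$ if and only if $[o_2]=0$. 3. If $\ker r\cong\mathbb Z_2$, then $\ker r$ is central in $\mathrm{Aut}_{LR}(\check{\mathcal C})$, there is a central extension $1\to\ker r\to\check G_b\to G_b\to1$ classified by $[o_2]$, and for every such extension there is a homomorphism $\check G_b\to\mathrm{Aut}_{LR}(\check{\mathcal C})$ that lifts the composite $\check G_b\to G_b\to\mathrm{Aut}_{LR}(\mathcal C)$ along $r$ and restricts to the inclusion on $\ker r$. -/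

import Mathlib

open Matrix
open scoped Kronecker ComplexConjugate IsMulCommutative

/-! ### Skeletal unitary braided fusion categories -/

/-- A unitary braided fusion category, presented by its skeletal data (anyon labels, orthonormal
bases of the fusion spaces, `F`-symbols and `R`-symbols).

`V` is the set of all basis states `|a,b;c;μ⟩` of all fusion spaces `V_c^{ab}`; the labels of
`v = |a,b;c;μ⟩` are `a = fst v`, `b = snd v`, `c = out v`. Thus `N_{ab}^c` is the number of
`v : V` with labels `(a,b;c)`.

* `F (α, β) (μ, ν)` is `[F^{abc}_d]_{(e,α,β),(f,μ,ν)}`, where `α : (a,b;e)`, `β : (e,c;d)`,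
  `μ : (b,c;f)`, `ν : (a,f;d)`; it is zero for all other quadruples of basis states.
* `R μ ν` is `[R^{ab}_c]_{μν}`, where `μ : (b,a;c)` and `ν : (a,b;c)`; it is zero for all other
  pairs of basis states. -/
structure UBFC where
  /-- anyon labels (simple objects) -/
  L : Type
  [fintypeL : Fintype L]
  [decEqL : DecidableEq L]
  /-- basis states of the fusion spaces -/
  V : Type
  [fintypeV : Fintype V]
  [decEqV : DecidableEq V]
  fst : V → L
  snd : V → L
  out : V → L
  /-- the vacuum -/
  one : L
  /-- the basis state `|1,a;a⟩` -/
  lunit : L → V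
  /-- the basis state `|a,1;a⟩` -/
  runit : L → V
  lunit_fst : ∀ a, fst (lunit a) = one
  lunit_snd : ∀ a, snd (lunit a) = a
  lunit_out : ∀ a, out (lunit a) = a
  lunit_unique : ∀ v, fst v = one → v = lunit (snd v)
  runit_fst : ∀ a, fst (runit a) = a
  runit_snd : ∀ a, snd (runit a) = one
  runit_out : ∀ a, out (runit a) = a
  runit_unique : ∀ v, snd v = one → v = runit (fst v)
  /-- charge conjugation -/
  dual : L → L
  dual_dual : ∀ a, dual (dual a) = a
  /-- the basis state `|a,ā;1⟩` -/
  pair : L → V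
  pair_fst : ∀ a, fst (pair a) = a
  pair_snd : ∀ a, snd (pair a) = dual a
  pair_out : ∀ a, out (pair a) = one
  pair_unique : ∀ v, out v = one → v = pair (fst v)
  F : Matrix (V × V) (V × V) ℂ
  F_support : ∀ α β μ ν, F (α, β) (μ, ν) ≠ 0 →
    out α = fst β ∧ out μ = snd ν ∧
    fst α = fst ν ∧ snd α = fst μ ∧ snd β = snd μ ∧ out β = out ν
  /-- `F` is unitary from the right-associated to the left-associated fusion trees. -/
  F_mul_conjTranspose : F * Fᴴ = diagonal fun p => if out p.1 = fst p.2 then 1 else 0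
  F_conjTranspose_mul : Fᴴ * F = diagonal fun p => if out p.1 = snd p.2 then 1 else 0
  /-- triangle equation: `F^{a1c}` is the identity -/
  triangle : ∀ v w, fst v = fst w → snd v = snd w →
    F (runit (fst v), v) (lunit (snd w), w) = if v = w then 1 else 0
  pentagon : ∀ α β γ μ κ l,
    ∑ ν, F (β, γ) (μ, ν) * F (α, ν) (κ, l) =
      ∑ δ, ∑ ε, ∑ ζ, F (α, β) (δ, ε) * F (ε, γ) (ζ, l) * F (δ, ζ) (μ, κ)
  /-- rigidity: `[F^{a ā a}_a]_{11} ≠ 0` -/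
  rigid : ∀ a, F (pair a, lunit a) (pair (dual a), runit a) ≠ 0
  R : Matrix V V ℂ
  R_support : ∀ μ ν, R μ ν ≠ 0 → fst μ = snd ν ∧ snd μ = fst ν ∧ out μ = out ν
  R_mul_conjTranspose : R * Rᴴ = 1
  /-- hexagon equation for the braiding -/
  hexagon : ∀ α β μ ν,
    ∑ l, ∑ γ, R α l * F (l, β) (γ, ν) * R γ μ =
      ∑ δ, ∑ s, ∑ t, F (α, β) (δ, s) * R s t * F (δ, t) (μ, ν)
  /-- hexagon equation for the inverse braiding `R⁻¹ = Rᴴ` -/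
  hexagon_inv : ∀ α β μ ν,
    ∑ l, ∑ γ, Rᴴ α l * F (l, β) (γ, ν) * Rᴴ γ μ =
      ∑ δ, ∑ s, ∑ t, F (α, β) (δ, s) * Rᴴ s t * F (δ, t) (μ, ν)

namespace UBFC

attribute [instance] UBFC.fintypeL UBFC.decEqL UBFC.fintypeV UBFC.decEqV

/-- `M_{a,b} = 1`: the double braid of `a` and `b` is the identity in every fusion channel. -/
def BraidsTrivially (C : UBFC) (a b : C.L) : Prop :=
  ∀ μ ν, C.fst μ = a → C.snd μ = b → (C.R * C.R) μ ν = if μ = ν then 1 else 0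

/-- `ψ` is a fermion with `ℤ/2` fusion rules: `ψ × ψ = 1` and `θ_ψ = -1`
(as `ψ` is Abelian and self-dual, its twist is `θ_ψ = R^{ψψ}_1`). -/
structure IsFermion (C : UBFC) (ψ : C.L) : Prop where
  dual_eq : C.dual ψ = ψ
  fusion : ∀ v, C.fst v = ψ → C.snd v = ψ → C.out v = C.one
  twist : C.R (C.pair ψ) (C.pair ψ) = -1

/-! ### Autoequivalences -/

/-- A braided autoequivalence of `C`, unitary (`σ = 1`) or anti-unitary (`σ` is complex
conjugation; the field automorphisms of `ℂ` over `ℝ` are exactly these two). It acts by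
`ρ |a,b;c;μ⟩ = ∑_ν U_{μν} |ρa,ρb;ρc;ν⟩`, extended linearly or anti-linearly. So, for
`v = |a,b;c;μ⟩` and `w = |ρa,ρb;ρc;ν⟩`, the entry `U v w` is the `U`-symbol
`U(ρa,ρb;ρc)_{μν}`, and `U v w = 0` for all other pairs. The vacuum
vertices are normalized by `U(1,a;a) = U(a,1;a) = 1`. -/
@[ext]
structure Autoequiv (C : UBFC) where
  perm : Equiv.Perm C.L
  σ : ℂ ≃ₐ[ℝ] ℂ
  U : Matrix C.V C.V ℂ
  support : ∀ v w, U v w ≠ 0 →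
    C.fst w = perm (C.fst v) ∧ C.snd w = perm (C.snd v) ∧ C.out w = perm (C.out v)
  unitary : U * Uᴴ = 1
  map_lunit : ∀ a, U (C.lunit a) (C.lunit (perm a)) = 1
  map_runit : ∀ a, U (C.runit a) (C.runit (perm a)) = 1
  map_F : C.F.map σ = (U ⊗ₖ U) * C.F * (U ⊗ₖ U)ᴴ
  map_R : C.R.map σ = U * C.R * Uᴴ

end UBFC

/-! ### Entrywise action of the automorphisms of `ℂ` over `ℝ` -/

theorem Complex.autReal_star (σ : ℂ ≃ₐ[ℝ] ℂ) (z : ℂ) : σ (star z) = star (σ z) := by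
  rcases Complex.real_algHom_eq_id_or_conj (σ : ℂ →ₐ[ℝ] ℂ) with h | h
  · have h' : ∀ x, σ x = x := fun x => by simpa using DFunLike.congr_fun h x
    simp [h']
  · have h' : ∀ x, σ x = (starRingEnd ℂ) x := fun x => by simpa using DFunLike.congr_fun h x
    simp [h']

theorem Complex.autReal_star_mul_self (σ : ℂ ≃ₐ[ℝ] ℂ) {z : ℂ} (hz : z * star z = 1) :
    σ z * star (σ z) = 1 := by
  rw [← Complex.autReal_star, ← map_mul, hz, map_one]

section
set_option linter.unusedSectionVars false
variable {m n k : Type} [Fintype m] [Fintype n] [Fintype k]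

theorem Matrix.mapAut_mul (σ : ℂ ≃ₐ[ℝ] ℂ) (A : Matrix m n ℂ) (B : Matrix n k ℂ) :
    (A * B).map σ = A.map σ * B.map σ := by
  ext i j
  simp [Matrix.mul_apply]

theorem Matrix.mapAut_conjTranspose (σ : ℂ ≃ₐ[ℝ] ℂ) (A : Matrix m n ℂ) :
    Aᴴ.map σ = (A.map σ)ᴴ := by
  ext i j
  exact Complex.autReal_star σ _

theorem Matrix.mapAut_kronecker (σ : ℂ ≃ₐ[ℝ] ℂ) (A : Matrix m n ℂ) (B : Matrix m k ℂ) :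
    (A ⊗ₖ B).map σ = A.map σ ⊗ₖ B.map σ := by
  ext i j
  simp

theorem Matrix.mapAut_one [DecidableEq m] (σ : ℂ ≃ₐ[ℝ] ℂ) : (1 : Matrix m m ℂ).map σ = 1 := by
  ext i j
  by_cases h : i = j <;> simp [Matrix.one_apply, h]

theorem Matrix.mapAut_mapAut (σ τ : ℂ ≃ₐ[ℝ] ℂ) (A : Matrix m n ℂ) :
    (A.map τ).map σ = A.map (σ * τ : ℂ ≃ₐ[ℝ] ℂ) := rfl

theorem Matrix.mul_apply_ne_zero {A : Matrix m n ℂ} {B : Matrix n k ℂ} {i : m} {j : k}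
    (h : (A * B) i j ≠ 0) : ∃ x, A i x ≠ 0 ∧ B x j ≠ 0 := by
  by_contra hc
  push Not at hc
  apply h
  rw [Matrix.mul_apply]
  refine Finset.sum_eq_zero fun x _ => ?_
  by_cases hx : A i x = 0
  · rw [hx, zero_mul]
  · rw [hc x hx, mul_zero]

end

namespace UBFC
variable {C : UBFC}

theorem lunit_iff (v : C.V) (a : C.L) : v = C.lunit a ↔ C.fst v = C.one ∧ C.snd v = a := by
  constructor
  · rintro rfl; exact ⟨C.lunit_fst a, C.lunit_snd a⟩
  · rintro ⟨h, rfl⟩; exact C.lunit_unique v h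

theorem runit_iff (v : C.V) (a : C.L) : v = C.runit a ↔ C.snd v = C.one ∧ C.fst v = a := by
  constructor
  · rintro rfl; exact ⟨C.runit_snd a, C.runit_fst a⟩
  · rintro ⟨h, rfl⟩; exact C.runit_unique v h

namespace Autoequiv

theorem unitary' (ρ : Autoequiv C) : ρ.Uᴴ * ρ.U = 1 := mul_eq_one_comm.mp ρ.unitary

theorem perm_one (ρ : Autoequiv C) : ρ.perm C.one = C.one := by
  have h := ρ.support (C.lunit C.one) (C.lunit (ρ.perm C.one)) (by rw [ρ.map_lunit]; simp)
  rw [← (congrArg ρ.perm (C.lunit_fst C.one)), ← h.1, C.lunit_fst]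

/-- The row of `U` at a vertex determined by its labels has a single non-zero entry. -/
theorem lunit_row (ρ : Autoequiv C) (a : C.L) (w : C.V) :
    ρ.U (C.lunit a) w = if w = C.lunit (ρ.perm a) then 1 else 0 := by
  split_ifs with h
  · rw [h, ρ.map_lunit]
  · by_contra hc
    obtain ⟨h1, h2, -⟩ := ρ.support _ _ hc
    refine h ((lunit_iff w _).2 ⟨?_, ?_⟩)
    · rw [h1, C.lunit_fst, ρ.perm_one]
    · rw [h2, C.lunit_snd]

theorem runit_row (ρ : Autoequiv C) (a : C.L) (w : C.V) :
    ρ.U (C.runit a) w = if w = C.runit (ρ.perm a) then 1 else 0 := by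
  split_ifs with h
  · rw [h, ρ.map_runit]
  · by_contra hc
    obtain ⟨h1, h2, -⟩ := ρ.support _ _ hc
    refine h ((runit_iff w _).2 ⟨?_, ?_⟩)
    · rw [h2, C.runit_snd, ρ.perm_one]
    · rw [h1, C.runit_fst]

/-- The identity autoequivalence. -/
noncomputable def id (C : UBFC) : Autoequiv C where
  perm := 1
  σ := 1
  U := 1
  support v w h := by
    have : v = w := by
      by_contra hc
      exact h (Matrix.one_apply_ne hc)
    subst this
    exact ⟨rfl, rfl, rfl⟩
  unitary := by simp
  map_lunit a := Matrix.one_apply_eq _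
  map_runit a := Matrix.one_apply_eq _
  map_F := by
    have : C.F.map (1 : ℂ ≃ₐ[ℝ] ℂ) = C.F := rfl
    simp [this]
  map_R := by
    have : C.R.map (1 : ℂ ≃ₐ[ℝ] ℂ) = C.R := rfl
    simp [this]

/-- The composite `g ∘ h`. -/
noncomputable def comp (g h : Autoequiv C) : Autoequiv C where
  perm := g.perm * h.perm
  σ := g.σ * h.σ
  U := h.U.map g.σ * g.U
  support v w hvw := by
    obtain ⟨x, hx, hxw⟩ := Matrix.mul_apply_ne_zero hvw
    have hx' : h.U v x ≠ 0 := fun h0 => hx (by simp [h0])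
    obtain ⟨h1, h2, h3⟩ := h.support v x hx'
    obtain ⟨k1, k2, k3⟩ := g.support x w hxw
    exact ⟨by rw [k1, h1]; rfl, by rw [k2, h2]; rfl, by rw [k3, h3]; rfl⟩
  unitary := by
    rw [conjTranspose_mul, Matrix.mul_assoc, ← Matrix.mul_assoc g.U, g.unitary, Matrix.one_mul,
      ← Matrix.mapAut_conjTranspose, ← Matrix.mapAut_mul, h.unitary, Matrix.mapAut_one]
  map_lunit a := by
    rw [Matrix.mul_apply]
    simp [lunit_row]
  map_runit a := by
    rw [Matrix.mul_apply]
    simp [runit_row]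
  map_F := by
    rw [← Matrix.mapAut_mapAut, h.map_F, Matrix.mapAut_mul, Matrix.mapAut_mul,
      Matrix.mapAut_conjTranspose, Matrix.mapAut_kronecker, g.map_F, Matrix.mul_kronecker_mul,
      conjTranspose_mul]
    simp only [Matrix.mul_assoc]
  map_R := by
    rw [← Matrix.mapAut_mapAut, h.map_R, Matrix.mapAut_mul, Matrix.mapAut_mul,
      Matrix.mapAut_conjTranspose, g.map_R, conjTranspose_mul]
    simp only [Matrix.mul_assoc]

/-- The inverse autoequivalence. -/
noncomputable def inv (g : Autoequiv C) : Autoequiv C where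
  perm := g.perm⁻¹
  σ := g.σ⁻¹
  U := g.Uᴴ.map (g.σ⁻¹ : ℂ ≃ₐ[ℝ] ℂ)
  support v w hvw := by
    have hx' : g.U w v ≠ 0 := fun h0 => hvw (by simp [h0])
    obtain ⟨h1, h2, h3⟩ := g.support w v hx'
    rw [h1, h2, h3]
    simp
  unitary := by
    rw [← Matrix.mapAut_conjTranspose, ← Matrix.mapAut_mul, conjTranspose_conjTranspose,
      g.unitary', Matrix.mapAut_one]
  map_lunit a := by
    have h := g.map_lunit (g.perm⁻¹ a)
    rw [show g.perm (g.perm⁻¹ a) = a from g.perm.apply_symm_apply a] at h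
    rw [Matrix.map_apply, Matrix.conjTranspose_apply, h, star_one, map_one]
  map_runit a := by
    have h := g.map_runit (g.perm⁻¹ a)
    rw [show g.perm (g.perm⁻¹ a) = a from g.perm.apply_symm_apply a] at h
    rw [Matrix.map_apply, Matrix.conjTranspose_apply, h, star_one, map_one]
  map_F := by
    have hk : (g.U ⊗ₖ g.U)ᴴ * (g.U ⊗ₖ g.U) = 1 := by
      rw [conjTranspose_kronecker, ← Matrix.mul_kronecker_mul, g.unitary', Matrix.one_kronecker_one]
    have h : (g.U ⊗ₖ g.U)ᴴ * C.F.map g.σ * (g.U ⊗ₖ g.U) = C.F := by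
      rw [g.map_F, Matrix.mul_assoc, Matrix.mul_assoc, Matrix.mul_assoc, hk, Matrix.mul_one,
        ← Matrix.mul_assoc, hk, Matrix.one_mul]
    have hs : (C.F.map g.σ).map (g.σ⁻¹ : ℂ ≃ₐ[ℝ] ℂ) = C.F := by
      rw [Matrix.mapAut_mapAut, inv_mul_cancel]; rfl
    conv_lhs => rw [← h]
    rw [Matrix.mapAut_mul, Matrix.mapAut_mul, hs, ← Matrix.mapAut_kronecker,
      ← conjTranspose_kronecker, ← Matrix.mapAut_conjTranspose, conjTranspose_conjTranspose]
  map_R := by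
    have h : g.Uᴴ * C.R.map g.σ * g.U = C.R := by
      rw [g.map_R, Matrix.mul_assoc, Matrix.mul_assoc, Matrix.mul_assoc, g.unitary',
        Matrix.mul_one, ← Matrix.mul_assoc, g.unitary', Matrix.one_mul]
    have hs : (C.R.map g.σ).map (g.σ⁻¹ : ℂ ≃ₐ[ℝ] ℂ) = C.R := by
      rw [Matrix.mapAut_mapAut, inv_mul_cancel]; rfl
    conv_lhs => rw [← h]
    rw [Matrix.mapAut_mul, Matrix.mapAut_mul, hs, ← Matrix.mapAut_conjTranspose,
      conjTranspose_conjTranspose]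

/-- Autoequivalences form a group under composition. -/
noncomputable instance : Group (Autoequiv C) where
  one := id C
  mul := comp
  inv := inv
  mul_assoc a b c := by
    apply Autoequiv.ext
    · exact mul_assoc a.perm b.perm c.perm
    · exact mul_assoc a.σ b.σ c.σ
    · change c.U.map (a.σ * b.σ : ℂ ≃ₐ[ℝ] ℂ) * (b.U.map a.σ * a.U) =
        (c.U.map b.σ * b.U).map a.σ * a.U
      rw [Matrix.mapAut_mul, Matrix.mapAut_mapAut, Matrix.mul_assoc]
  one_mul a := by
    apply Autoequiv.ext
    · exact one_mul a.perm
    · exact one_mul a.σ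
    · exact Matrix.mul_one _
  mul_one a := by
    apply Autoequiv.ext
    · exact mul_one a.perm
    · exact mul_one a.σ
    · change (1 : Matrix C.V C.V ℂ).map a.σ * a.U = a.U
      rw [Matrix.mapAut_one, Matrix.one_mul]
  inv_mul_cancel a := by
    apply Autoequiv.ext
    · exact inv_mul_cancel a.perm
    · exact inv_mul_cancel a.σ
    · change a.U.map (a.σ⁻¹ : ℂ ≃ₐ[ℝ] ℂ) * a.Uᴴ.map (a.σ⁻¹ : ℂ ≃ₐ[ℝ] ℂ) = 1
      rw [← Matrix.mapAut_mul, a.unitary, Matrix.mapAut_one]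

theorem mul_perm (g h : Autoequiv C) : (g * h).perm = g.perm * h.perm := rfl
theorem mul_σ (g h : Autoequiv C) : (g * h).σ = g.σ * h.σ := rfl
theorem mul_U (g h : Autoequiv C) : (g * h).U = h.U.map g.σ * g.U := rfl
theorem one_perm : (1 : Autoequiv C).perm = 1 := rfl
theorem one_σ : (1 : Autoequiv C).σ = 1 := rfl
theorem one_U : (1 : Autoequiv C).U = 1 := rfl
theorem inv_perm (g : Autoequiv C) : (g⁻¹).perm = g.perm⁻¹ := rfl
theorem inv_σ (g : Autoequiv C) : (g⁻¹).σ = g.σ⁻¹ := rfl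
theorem inv_U (g : Autoequiv C) : (g⁻¹).U = g.Uᴴ.map (g.σ⁻¹ : ℂ ≃ₐ[ℝ] ℂ) := rfl

/-- `ρ` is the locality-respecting natural isomorphism with phases `γ`:
`|a,b;c;μ⟩ ↦ (γ_a γ_b / γ_c) |a,b;c;μ⟩`, where `γ_ψ = 1`. -/
structure IsNatIsoLR (ψ : C.L) (ρ : Autoequiv C) (γ : C.L → ℂ) : Prop where
  phase : ∀ a, γ a * star (γ a) = 1
  psi : γ ψ = 1
  perm_eq : ρ.perm = 1
  σ_eq : ρ.σ = 1
  U_eq : ρ.U = diagonal fun v => γ (C.fst v) * γ (C.snd v) / γ (C.out v)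

/-- The locality-respecting natural isomorphisms, as a subgroup of all autoequivalences. -/
noncomputable def natIsoLR (C : UBFC) (ψ : C.L) : Subgroup (Autoequiv C) where
  carrier := {ρ | ∃ γ, IsNatIsoLR ψ ρ γ}
  one_mem' := ⟨fun _ => 1, by simp, rfl, rfl, rfl, by simp [one_U]⟩
  mul_mem' := by
    rintro g h ⟨γ, hγ⟩ ⟨δ, hδ⟩
    refine ⟨fun a => γ a * δ a, fun a => ?_, ?_, ?_, ?_, ?_⟩
    · rw [star_mul', mul_mul_mul_comm, hγ.phase, hδ.phase, one_mul]
    · simp [hγ.psi, hδ.psi]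
    · rw [mul_perm, hγ.perm_eq, hδ.perm_eq, one_mul]
    · rw [mul_σ, hγ.σ_eq, hδ.σ_eq, one_mul]
    · have : h.U.map (1 : ℂ ≃ₐ[ℝ] ℂ) = h.U := rfl
      rw [mul_U, hγ.σ_eq, this, hγ.U_eq, hδ.U_eq, diagonal_mul_diagonal]
      congr 1
      funext v
      ring
  inv_mem' := by
    rintro g ⟨γ, hγ⟩
    refine ⟨fun a => star (γ a), fun a => ?_, ?_, ?_, ?_, ?_⟩
    · rw [star_star, mul_comm, hγ.phase]
    · simp [hγ.psi]
    · rw [inv_perm, hγ.perm_eq, inv_one]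
    · rw [inv_σ, hγ.σ_eq, inv_one]
    · have : g.Uᴴ.map (1 : ℂ ≃ₐ[ℝ] ℂ) = g.Uᴴ := rfl
      rw [inv_U, hγ.σ_eq, inv_one, this, hγ.U_eq, diagonal_conjTranspose]
      congr 1
      funext v
      simp

/-- The vertex `|a,ā;1⟩` can only be sent to the vertex `|ρa,\overline{ρa};1⟩`. -/
theorem pair_row (ρ : Autoequiv C) (a : C.L) (w : C.V) (h : ρ.U (C.pair a) w ≠ 0) :
    w = C.pair (ρ.perm a) := by
  obtain ⟨h1, -, h3⟩ := ρ.support _ _ h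
  rw [C.pair_out, ρ.perm_one] at h3
  rw [C.pair_unique w h3, h1, C.pair_fst]

theorem perm_psi {ψ : C.L} {ρ : Autoequiv C} (h : ρ.U (C.pair ψ) (C.pair ψ) = 1) :
    ρ.perm ψ = ψ := by
  have h1 := (ρ.support (C.pair ψ) (C.pair ψ) (by rw [h]; simp)).1
  rw [C.pair_fst] at h1
  exact h1.symm

/-- The autoequivalences with `ρ |ψ,ψ;1⟩ = |ψ,ψ;1⟩`, that is, `ρψ = ψ` and `U(ψ,ψ;1) = 1`. -/
noncomputable def fixingPsi (C : UBFC) (ψ : C.L) : Subgroup (Autoequiv C) where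
  carrier := {ρ | ρ.U (C.pair ψ) (C.pair ψ) = 1}
  one_mem' := Matrix.one_apply_eq _
  mul_mem' := by
    intro g h hg hh
    have hg' : g.U (C.pair ψ) (C.pair ψ) = 1 := hg
    have hh' : h.U (C.pair ψ) (C.pair ψ) = 1 := hh
    change (h.U.map g.σ * g.U) (C.pair ψ) (C.pair ψ) = 1
    rw [Matrix.mul_apply, Finset.sum_eq_single (C.pair ψ)]
    · simp [hg', hh']
    · intro w _ hw
      have : h.U (C.pair ψ) w = 0 := by
        by_contra hc
        exact hw (by rw [pair_row h ψ w hc, perm_psi hh'])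
      simp [this]
    · simp
  inv_mem' := by
    intro g hg
    have hg' : g.U (C.pair ψ) (C.pair ψ) = 1 := hg
    change g.Uᴴ.map (g.σ⁻¹ : ℂ ≃ₐ[ℝ] ℂ) (C.pair ψ) (C.pair ψ) = 1
    rw [Matrix.map_apply, Matrix.conjTranspose_apply, hg', star_one, map_one]

theorem conj_mem_natIsoLR {ψ : C.L} {n ρ : Autoequiv C} (hn : n ∈ natIsoLR C ψ)
    (hρ : ρ ∈ fixingPsi C ψ) : ρ * n * ρ⁻¹ ∈ natIsoLR C ψ := by
  obtain ⟨γ, hγ⟩ := hn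
  have hp : ρ.perm⁻¹ ψ = ψ := by
    rw [Equiv.Perm.inv_eq_iff_eq]; exact (perm_psi hρ).symm
  refine ⟨fun a => ρ.σ (γ (ρ.perm⁻¹ a)), fun a => ?_, ?_, ?_, ?_, ?_⟩
  · exact Complex.autReal_star_mul_self _ (hγ.phase _)
  · simp only [hp, hγ.psi, map_one]
  · rw [mul_perm, mul_perm, hγ.perm_eq, inv_perm, mul_one, mul_inv_cancel]
  · rw [mul_σ, mul_σ, hγ.σ_eq, inv_σ, mul_one, mul_inv_cancel]
  · have h1 : (ρ⁻¹).U.map (ρ * n).σ = ρ.Uᴴ := by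
      rw [inv_U, mul_σ, hγ.σ_eq, mul_one, Matrix.mapAut_mapAut, mul_inv_cancel]; rfl
    rw [mul_U, h1, mul_U]
    have h2 : n.U.map ρ.σ * ρ.U = ρ.U * diagonal fun v =>
        ρ.σ (γ (ρ.perm⁻¹ (C.fst v))) * ρ.σ (γ (ρ.perm⁻¹ (C.snd v))) /
          ρ.σ (γ (ρ.perm⁻¹ (C.out v))) := by
      rw [hγ.U_eq, diagonal_map (map_zero _)]
      ext v w
      rw [diagonal_mul, mul_diagonal]
      by_cases hvw : ρ.U v w = 0
      · simp [hvw]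
      · obtain ⟨k1, k2, k3⟩ := ρ.support v w hvw
        rw [k1, k2, k3]
        simp [mul_comm]
    rw [h2, ← Matrix.mul_assoc, ρ.unitary', Matrix.one_mul]

instance (C : UBFC) (ψ : C.L) : ((natIsoLR C ψ).subgroupOf (fixingPsi C ψ)).Normal where
  conj_mem n hn g := by
    rw [Subgroup.mem_subgroupOf] at hn ⊢
    exact conj_mem_natIsoLR hn g.2

end Autoequiv

/-- `Aut_LR(C)`: the autoequivalences with `U(ψ,ψ;1) = 1`, modulo the locality-respecting natural
isomorphisms. -/
abbrev AutLR (C : UBFC) (ψ : C.L) : Type :=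
  ↥(Autoequiv.fixingPsi C ψ) ⧸ (Autoequiv.natIsoLR C ψ).subgroupOf (Autoequiv.fixingPsi C ψ)

end UBFC

/-! ### Super-modular and spin modular categories, minimal modular extensions -/

/-- A super-modular category: a unitary braided fusion category whose only non-trivial invisible
(transparent) particle is a fermion `ψ`. -/
structure SuperModularCategory extends UBFC where
  psi : L
  fermion : toUBFC.IsFermion psi
  transparent_iff : ∀ a, (∀ b, toUBFC.BraidsTrivially a b) ↔ a = one ∨ a = psi

/-- A spin modular category: a unitary modular tensor category (the braiding is non-degenerate: only
the vacuum is transparent) with a preferred fermion `ψ`. -/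
structure SpinModularCategory extends UBFC where
  psi : L
  fermion : toUBFC.IsFermion psi
  modular : ∀ a, (∀ b, toUBFC.BraidsTrivially a b) → a = one

/-- `D` is a minimal modular extension of `C`: the super-modular category `C` is contained in the
spin modular category `D` as the full braided subcategory `D₀` of all particles that braid trivially
with `ψ`, and the preferred fermion of `D` is that of `C`.

`incl` is the inclusion on labels; `W v w` are the coefficients of the inclusion
`|a,b;c;μ⟩ ↦ ∑_ν W_{μν} |a,b;c;ν⟩` of the fusion spaces of `C` onto those of `D` with labels in
`D₀`. It preserves inner products, vacuum vertices, `|ψ,ψ;1⟩`, `F` and `R`. -/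
structure MinimalModularExtension (C : SuperModularCategory) (D : SpinModularCategory) where
  incl : C.L → D.L
  incl_injective : Function.Injective incl
  range_incl : ∀ a, a ∈ Set.range incl ↔ D.BraidsTrivially a D.psi
  incl_psi : incl C.psi = D.psi
  W : Matrix C.V D.V ℂ
  support : ∀ v w, W v w ≠ 0 →
    D.fst w = incl (C.fst v) ∧ D.snd w = incl (C.snd v) ∧ D.out w = incl (C.out v)
  isometry : W * Wᴴ = 1
  full : ∀ w, D.fst w ∈ Set.range incl → D.snd w ∈ Set.range incl → D.out w ∈ Set.range incl →
    ∀ x, (Wᴴ * W) w x = if w = x then 1 else 0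
  map_lunit : ∀ a, W (C.lunit a) (D.lunit (incl a)) = 1
  map_runit : ∀ a, W (C.runit a) (D.runit (incl a)) = 1
  map_psi : W (C.pair C.psi) (D.pair D.psi) = 1
  map_F : C.F = (W ⊗ₖ W) * D.F * (W ⊗ₖ W)ᴴ
  map_R : C.R = W * D.R * Wᴴ

namespace UBFC.Autoequiv
variable {D : UBFC}

theorem braidsTrivially_map {ψ : D.L} {ρ : Autoequiv D} (hρ : ρ ∈ fixingPsi D ψ) {a : D.L}
    (ha : D.BraidsTrivially a ψ) : D.BraidsTrivially (ρ.perm a) ψ := by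
  intro μ ν h1 h2
  have hR : D.R * D.R = ρ.Uᴴ * ((D.R * D.R).map ρ.σ * ρ.U) := by
    rw [Matrix.mapAut_mul, ρ.map_R]
    simp only [Matrix.mul_assoc]
    rw [ρ.unitary', Matrix.mul_one, ← Matrix.mul_assoc ρ.Uᴴ ρ.U, ρ.unitary', Matrix.one_mul,
      ← Matrix.mul_assoc ρ.Uᴴ ρ.U, ρ.unitary', Matrix.one_mul]
  have key : ∀ x, ρ.U x μ ≠ 0 → ((D.R * D.R).map ρ.σ * ρ.U) x ν = ρ.U x ν := by
    intro x hx
    obtain ⟨k1, k2, -⟩ := ρ.support x μ hx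
    have hb := fun y => ha x y (ρ.perm.injective (k1.symm.trans h1))
      (ρ.perm.injective ((k2.symm.trans h2).trans (perm_psi hρ).symm))
    rw [Matrix.mul_apply, Finset.sum_eq_single x]
    · rw [Matrix.map_apply, hb, if_pos rfl, map_one, one_mul]
    · intro y _ hy
      rw [Matrix.map_apply, hb, if_neg (Ne.symm hy), map_zero, zero_mul]
    · simp
  rw [hR, Matrix.mul_apply, ← Matrix.one_apply (i := μ) (j := ν), ← ρ.unitary', Matrix.mul_apply]
  refine Finset.sum_congr rfl fun x _ => ?_
  by_cases hx : ρ.U x μ = 0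
  · simp [hx]
  · rw [key x hx]

theorem braidsTrivially_map_iff {ψ : D.L} {ρ : Autoequiv D} (hρ : ρ ∈ fixingPsi D ψ) (a : D.L) :
    D.BraidsTrivially (ρ.perm a) ψ ↔ D.BraidsTrivially a ψ := by
  refine ⟨fun h => ?_, braidsTrivially_map hρ⟩
  have h' := braidsTrivially_map (inv_mem hρ) h
  rwa [inv_perm, show ρ.perm⁻¹ (ρ.perm a) = a from ρ.perm.symm_apply_apply a] at h'

end UBFC.Autoequiv

namespace MinimalModularExtension
open UBFC

variable {C : SuperModularCategory} {D : SpinModularCategory} (E : MinimalModularExtension C D)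

theorem mem_range_perm_iff (ρ : Autoequiv.fixingPsi D.toUBFC D.psi) (a : D.L) :
    ρ.1.perm a ∈ Set.range E.incl ↔ a ∈ Set.range E.incl := by
  rw [E.range_incl, E.range_incl]
  exact Autoequiv.braidsTrivially_map_iff ρ.2 a

theorem W_lunit_row (a : C.L) (w : D.V) :
    E.W (C.lunit a) w = if w = D.lunit (E.incl a) then 1 else 0 := by
  split_ifs with h
  · rw [h, E.map_lunit]
  · by_contra hc
    obtain ⟨h1, h2, -⟩ := E.support _ _ hc
    have h3 := (E.support (C.lunit C.one) (D.lunit (E.incl C.one))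
      (by rw [E.map_lunit]; simp)).1
    rw [C.lunit_fst, D.lunit_fst] at h3
    refine h ((lunit_iff w _).2 ⟨?_, ?_⟩)
    · rw [h1, C.lunit_fst, h3]
    · rw [h2, C.lunit_snd]

theorem W_runit_row (a : C.L) (w : D.V) :
    E.W (C.runit a) w = if w = D.runit (E.incl a) then 1 else 0 := by
  split_ifs with h
  · rw [h, E.map_runit]
  · by_contra hc
    obtain ⟨h1, h2, -⟩ := E.support _ _ hc
    have h3 := (E.support (C.runit C.one) (D.runit (E.incl C.one))
      (by rw [E.map_runit]; simp)).2.1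
    rw [C.runit_snd, D.runit_snd] at h3
    refine h ((runit_iff w _).2 ⟨?_, ?_⟩)
    · rw [h2, C.runit_snd, h3]
    · rw [h1, C.runit_fst]

/-- The restriction of `ρ` to the labels of `C`. -/
noncomputable def permRestrict (ρ : Autoequiv.fixingPsi D.toUBFC D.psi) : Equiv.Perm C.L :=
  ((Equiv.ofInjective E.incl E.incl_injective).trans
    (ρ.1.perm.subtypePerm (E.mem_range_perm_iff ρ))).trans
    (Equiv.ofInjective E.incl E.incl_injective).symm

theorem incl_permRestrict (ρ : Autoequiv.fixingPsi D.toUBFC D.psi) (a : C.L) :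
    E.incl (E.permRestrict ρ a) = ρ.1.perm (E.incl a) := by
  simp only [permRestrict, Equiv.trans_apply]
  rw [Equiv.apply_ofInjective_symm E.incl_injective]
  rfl

/-- The rows of `W^σ U` are supported on vertices with labels in `C`, hence fixed by the
projector `Wᴴ W`. -/
theorem mul_proj (ρ : Autoequiv.fixingPsi D.toUBFC D.psi) (σ : ℂ ≃ₐ[ℝ] ℂ) :
    E.W.map σ * ρ.1.U * (E.Wᴴ * E.W) = E.W.map σ * ρ.1.U := by
  ext v w
  rw [Matrix.mul_apply]
  have key : ∀ x, (E.W.map σ * ρ.1.U) v x * (E.Wᴴ * E.W) x w =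
      (E.W.map σ * ρ.1.U) v x * if x = w then 1 else 0 := by
    intro x
    by_cases hx : (E.W.map σ * ρ.1.U) v x = 0
    · simp [hx]
    · obtain ⟨y, hy, hyx⟩ := Matrix.mul_apply_ne_zero hx
      have hy' : E.W v y ≠ 0 := fun h0 => hy (by simp [h0])
      obtain ⟨h1, h2, h3⟩ := E.support v y hy'
      obtain ⟨k1, k2, k3⟩ := ρ.1.support y x hyx
      rw [E.full x (by rw [k1, E.mem_range_perm_iff, h1]; exact ⟨_, rfl⟩)
        (by rw [k2, E.mem_range_perm_iff, h2]; exact ⟨_, rfl⟩)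
        (by rw [k3, E.mem_range_perm_iff, h3]; exact ⟨_, rfl⟩)]
  simp [key]

/-- The restriction to `C` of an autoequivalence `ρ` of `D`; it is characterized by
`incl ∘ (restrictAut ρ) = ρ ∘ incl`. -/
noncomputable def restrictAut (ρ : Autoequiv.fixingPsi D.toUBFC D.psi) : Autoequiv C.toUBFC where
  perm := E.permRestrict ρ
  σ := ρ.1.σ
  U := E.W.map ρ.1.σ * ρ.1.U * E.Wᴴ
  support v w hvw := by
    obtain ⟨x, hx, hxw⟩ := Matrix.mul_apply_ne_zero hvw
    obtain ⟨y, hy, hyx⟩ := Matrix.mul_apply_ne_zero hx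
    have hy' : E.W v y ≠ 0 := fun h0 => hy (by simp [h0])
    have hx' : E.W w x ≠ 0 := fun h0 => hxw (by simp [h0])
    obtain ⟨h1, h2, h3⟩ := E.support v y hy'
    obtain ⟨k1, k2, k3⟩ := ρ.1.support y x hyx
    obtain ⟨l1, l2, l3⟩ := E.support w x hx'
    refine ⟨?_, ?_, ?_⟩ <;> apply E.incl_injective <;> rw [incl_permRestrict]
    · rw [← l1, k1, h1]
    · rw [← l2, k2, h2]
    · rw [← l3, k3, h3]
  unitary := by
    rw [conjTranspose_mul, conjTranspose_conjTranspose, ← Matrix.mul_assoc,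
      Matrix.mul_assoc _ E.Wᴴ, E.mul_proj, conjTranspose_mul, Matrix.mul_assoc,
      ← Matrix.mul_assoc ρ.1.U, ρ.1.unitary, Matrix.one_mul, ← Matrix.mapAut_conjTranspose,
      ← Matrix.mapAut_mul, E.isometry, Matrix.mapAut_one]
  map_lunit a := by
    have h : ∀ x, (E.W.map ρ.1.σ * ρ.1.U) (C.lunit a) x =
        if x = D.lunit (ρ.1.perm (E.incl a)) then 1 else 0 := fun x => by
      rw [Matrix.mul_apply]
      simp [W_lunit_row, Autoequiv.lunit_row]
    rw [Matrix.mul_apply]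
    simp [h, W_lunit_row, incl_permRestrict]
  map_runit a := by
    have h : ∀ x, (E.W.map ρ.1.σ * ρ.1.U) (C.runit a) x =
        if x = D.runit (ρ.1.perm (E.incl a)) then 1 else 0 := fun x => by
      rw [Matrix.mul_apply]
      simp [W_runit_row, Autoequiv.runit_row]
    rw [Matrix.mul_apply]
    simp [h, W_runit_row, incl_permRestrict]
  map_F := by
    have h : (E.W.map ρ.1.σ * ρ.1.U * E.Wᴴ) * E.W = E.W.map ρ.1.σ * ρ.1.U := by
      rw [Matrix.mul_assoc, E.mul_proj]
    set X := E.W.map ρ.1.σ * ρ.1.U * E.Wᴴ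
    have h2 : (X ⊗ₖ X) * C.F * (X ⊗ₖ X)ᴴ =
        ((X ⊗ₖ X) * (E.W ⊗ₖ E.W)) * D.F * ((X ⊗ₖ X) * (E.W ⊗ₖ E.W))ᴴ := by
      conv_lhs => rw [E.map_F]
      rw [conjTranspose_mul]
      simp only [Matrix.mul_assoc]
    rw [h2, ← Matrix.mul_kronecker_mul, h]
    conv_lhs => rw [E.map_F]
    rw [Matrix.mul_kronecker_mul, Matrix.mapAut_mul, Matrix.mapAut_mul, ρ.1.map_F,
      Matrix.mapAut_conjTranspose, Matrix.mapAut_kronecker, conjTranspose_mul]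
    simp only [Matrix.mul_assoc]
  map_R := by
    have h : (E.W.map ρ.1.σ * ρ.1.U * E.Wᴴ) * E.W = E.W.map ρ.1.σ * ρ.1.U := by
      rw [Matrix.mul_assoc, E.mul_proj]
    set X := E.W.map ρ.1.σ * ρ.1.U * E.Wᴴ
    have h2 : X * C.R * Xᴴ = (X * E.W) * D.R * (X * E.W)ᴴ := by
      conv_lhs => rw [E.map_R]
      rw [conjTranspose_mul X]
      simp only [Matrix.mul_assoc]
    rw [h2, h]
    conv_lhs => rw [E.map_R]
    rw [Matrix.mapAut_mul, Matrix.mapAut_mul, ρ.1.map_R,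
      Matrix.mapAut_conjTranspose, conjTranspose_mul]
    simp only [Matrix.mul_assoc]

theorem W_pair_row (w : D.V) :
    E.W (C.pair C.psi) w = if w = D.pair D.psi then 1 else 0 := by
  split_ifs with h
  · rw [h, E.map_psi]
  · by_contra hc
    obtain ⟨h1, -, h3⟩ := E.support _ _ hc
    have h4 := (E.support _ _ (by rw [E.map_psi]; simp : E.W (C.pair C.psi) (D.pair D.psi) ≠ 0)).2.2
    rw [C.pair_out, D.pair_out] at h4
    rw [C.pair_out, ← h4] at h3
    rw [C.pair_fst, E.incl_psi] at h1
    exact h (by rw [D.pair_unique w h3, h1])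

theorem restrictAut_mem (ρ : Autoequiv.fixingPsi D.toUBFC D.psi) :
    E.restrictAut ρ ∈ Autoequiv.fixingPsi C.toUBFC C.psi := by
  have hρ : ρ.1.U (D.pair D.psi) (D.pair D.psi) = 1 := ρ.2
  change (E.W.map ρ.1.σ * ρ.1.U * E.Wᴴ) (C.pair C.psi) (C.pair C.psi) = 1
  have h : ∀ x, (E.W.map ρ.1.σ * ρ.1.U) (C.pair C.psi) x = ρ.1.U (D.pair D.psi) x := fun x => by
    rw [Matrix.mul_apply]
    simp [W_pair_row]
  rw [Matrix.mul_apply]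
  simp [h, W_pair_row, hρ]

/-- Restriction to `C` as a homomorphism on autoequivalences with `U(ψ,ψ;1) = 1`. -/
noncomputable def restrictHom :
    Autoequiv.fixingPsi D.toUBFC D.psi →* Autoequiv.fixingPsi C.toUBFC C.psi :=
  MonoidHom.mk' (fun ρ => ⟨E.restrictAut ρ, E.restrictAut_mem ρ⟩) fun ρ τ => by
    apply Subtype.ext
    apply Autoequiv.ext
    · ext a
      apply E.incl_injective
      change E.incl (E.permRestrict (ρ * τ) a) =
        E.incl (E.permRestrict ρ (E.permRestrict τ a))
      rw [incl_permRestrict, incl_permRestrict, incl_permRestrict]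
      rfl
    · rfl
    · change E.W.map (ρ.1.σ * τ.1.σ : ℂ ≃ₐ[ℝ] ℂ) * (τ.1.U.map ρ.1.σ * ρ.1.U) * E.Wᴴ =
        (E.W.map τ.1.σ * τ.1.U * E.Wᴴ).map ρ.1.σ * (E.W.map ρ.1.σ * ρ.1.U * E.Wᴴ)
      have h : (E.W.map τ.1.σ * τ.1.U * E.Wᴴ).map ρ.1.σ * E.W.map ρ.1.σ =
          E.W.map (ρ.1.σ * τ.1.σ : ℂ ≃ₐ[ℝ] ℂ) * τ.1.U.map ρ.1.σ := by
        rw [← Matrix.mapAut_mul, Matrix.mul_assoc, E.mul_proj, Matrix.mapAut_mul,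
          Matrix.mapAut_mapAut]
      rw [Matrix.mul_assoc (E.W.map ρ.1.σ), ← Matrix.mul_assoc _ (E.W.map ρ.1.σ), h]
      simp only [Matrix.mul_assoc]

theorem restrictAut_natIsoLR {ρ : Autoequiv.fixingPsi D.toUBFC D.psi}
    (h : ρ.1 ∈ Autoequiv.natIsoLR D.toUBFC D.psi) :
    E.restrictAut ρ ∈ Autoequiv.natIsoLR C.toUBFC C.psi := by
  obtain ⟨γ, hγ⟩ := h
  refine ⟨fun a => γ (E.incl a), fun a => hγ.phase _, ?_, ?_, hγ.σ_eq, ?_⟩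
  · simp only [E.incl_psi, hγ.psi]
  · ext a
    apply E.incl_injective
    change E.incl (E.permRestrict ρ a) = E.incl a
    rw [incl_permRestrict, hγ.perm_eq]
    rfl
  · change E.W.map ρ.1.σ * ρ.1.U * E.Wᴴ = _
    have h1 : E.W.map (1 : ℂ ≃ₐ[ℝ] ℂ) = E.W := rfl
    rw [hγ.σ_eq, h1, hγ.U_eq]
    have h2 : E.W * diagonal (fun v => γ (D.fst v) * γ (D.snd v) / γ (D.out v)) =
        diagonal (fun v => γ (E.incl (C.fst v)) * γ (E.incl (C.snd v)) / γ (E.incl (C.out v))) *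
          E.W := by
      ext v w
      rw [mul_diagonal, diagonal_mul]
      by_cases hvw : E.W v w = 0
      · simp [hvw]
      · obtain ⟨k1, k2, k3⟩ := E.support v w hvw
        rw [k1, k2, k3, mul_comm]
    rw [h2, Matrix.mul_assoc, E.isometry, Matrix.mul_one]

/-- The restriction map `r : Aut_LR(D) → Aut_LR(C)`. -/
noncomputable def restrict : AutLR D.toUBFC D.psi →* AutLR C.toUBFC C.psi :=
  QuotientGroup.map _ _ E.restrictHom fun ρ hρ => by
    rw [Subgroup.mem_subgroupOf] at hρ
    exact E.restrictAut_natIsoLR hρ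

end MinimalModularExtension

/-! ### The action on an Abelian kernel, and classes of central extensions -/

namespace KernelLift
open groupCohomology

variable {A Q : Type} [Group A] [Group Q] (r : A →* Q) [IsMulCommutative r.ker]

/-- Conjugation action of the image of `r` on the Abelian group `ker r`: `r a` acts by
`k ↦ a k a⁻¹`. -/
noncomputable def conjRange : r.range →* MulAut r.ker :=
  (QuotientGroup.lift r.ker (MulAut.conjNormal (H := r.ker)) fun x hx => by
    rw [MonoidHom.mem_ker]
    ext k
    have h := congrArg Subtype.val (mul_comm (⟨x, hx⟩ : r.ker) k)
    simp only [Subgroup.coe_mul] at h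
    simp [h]).comp
    (QuotientGroup.quotientKerEquivRange r).symm.toMonoidHom

theorem conjRange_apply (a : A) (k : r.ker) :
    (conjRange r ⟨r a, a, rfl⟩ k : A) = a * k * a⁻¹ := by
  have : (QuotientGroup.quotientKerEquivRange r).symm ⟨r a, a, rfl⟩ = (a : A ⧸ r.ker) := by
    rw [MulEquiv.symm_apply_eq]
    rfl
  simp [conjRange, this]

variable {G : Type} [Group G] (ρ : G →* Q) (hρ : ∀ g, ρ g ∈ r.range)

/-- `ker r` as a `G`-module, where `g` acts by `k ↦ a k a⁻¹` for any `a` with `r a = ρ g`. -/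
noncomputable def kerRep : Rep ℤ G :=
  letI : MulDistribMulAction G r.ker :=
    MulDistribMulAction.compHom r.ker ((conjRange r).comp (ρ.codRestrict r.range hρ))
  Rep.ofMulDistribMulAction G r.ker

/-- A `ker r`-valued 2-cochain, as a 2-cochain with values in the `G`-module `ker r`. -/
noncomputable def cochain (o : G → G → r.ker) : G × G → kerRep r ρ hρ :=
  fun p => (Additive.ofMul (o p.1 p.2) : Additive r.ker)

theorem kerRep_apply {g : G} {a : A} (h : r a = ρ g) (k : r.ker) :
    (kerRep r ρ hρ).ρ g (Additive.ofMul k : Additive r.ker) =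
      (Additive.ofMul (⟨a * k * a⁻¹, r.normal_ker.conj_mem k k.2 a⟩ : r.ker) :
        Additive r.ker) := by
  have h1 : (ρ.codRestrict r.range hρ) g = ⟨r a, a, rfl⟩ := Subtype.ext h.symm
  have h2 : conjRange r ((ρ.codRestrict r.range hρ) g) k =
      ⟨a * k * a⁻¹, r.normal_ker.conj_mem k k.2 a⟩ := by
    rw [h1]
    exact Subtype.ext (conjRange_apply r a k)
  rw [← h2]
  rfl

/-- The cochain `o : G × G → ker r` is a 2-cocycle and represents the class `c ∈ H²(G, ker r)`. -/
def Represents (o : G → G → r.ker) (c : H2 (kerRep r ρ hρ)) : Prop :=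
  ∃ h : cochain r ρ hρ o ∈ cocycles₂ (kerRep r ρ hρ), H2π (kerRep r ρ hρ) ⟨_, h⟩ = c

/-- `S : 1 → ker r → Ĝ → G → 1` is a central extension classified by `c ∈ H²(G, ker r)`: for some
section `t`, the cocycle `(g,h) ↦ t(g) t(h) t(gh)⁻¹` represents `c`. -/
def IsCentralExtensionClassifiedBy {G' : Type} [Group G'] (S : GroupExtension r.ker G' G)
    (c : H2 (kerRep r ρ hρ)) : Prop :=
  S.inl.range ≤ Subgroup.center G' ∧
    ∃ (t : S.Section) (z : G → G → r.ker),
      (∀ g h, S.inl (z g h) = t.toFun g * t.toFun h * (t.toFun (g * h))⁻¹) ∧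
      Represents r ρ hρ z c

end KernelLift

/-! Once `E.restrict` is known to be a group homomorphism, the theorem is the classical obstruction
theory of lifting `ρ : G →* Q` along `r : A →* Q` with Abelian kernel; no further property of the
categories is used.

Any two set-theoretic lifts of `ρ` differ by a function `b : G → r.ker`, and replacing `s` by `b *
s` divides the obstruction cochain `o` by the coboundary of `b` (`IsLiftWithObstruction.mul_iff`).
Every coboundary arises in this way, so the obstruction cochains of lifts fill exactly one
cohomology class (`IsLiftWithObstruction.represents_iff`).

Everything else is read off from this equivalence. Independence of the lift is one direction. A
homomorphic lift is a lift whose cochain is constantly `1`, and that cochain lies in the class iff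
the class is zero.

For a central extension classified by the same class, the factor set `z` of a section `t` is the
obstruction cochain of some lift `s`. In general the factor set of `s` would then be `z⁻¹`; in a
group of order two inversion is trivial, so `t` and `s` have the same factor set and `k * t g ↦ k *
s g` is a homomorphism (`exists_monoidHom_of_factorSet_eq`). Such an extension exists: the pullback
of `r` along `ρ`. -/

namespace KernelLift
open groupCohomology

/-! ### Lifts along a homomorphism with Abelian kernel and their obstruction cochains -/

section Lifts
variable {A Q : Type} [Group A] [Group Q] (r : A →* Q)
variable {G : Type} [Group G] (ρ : G →* Q)

/-- `s` is a set-theoretic lift of `ρ` along `r`, and `o` is the inverse of its factor set. -/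
structure IsLiftWithObstruction (s : G → A) (o : G → G → r.ker) : Prop where
  map_eq : ∀ g, r (s g) = ρ g
  inv_eq : ∀ g h, ((o g h)⁻¹ : r.ker) = s g * s h * (s (g * h))⁻¹

variable {r ρ}

/-- The factor set of `s` is killed by `r` because `ρ` is multiplicative. -/
theorem exists_isLiftWithObstruction {s : G → A} (hs : ∀ g, r (s g) = ρ g) :
    ∃ o, IsLiftWithObstruction r ρ s o := by
  refine ⟨fun g h => ⟨s g * s h * (s (g * h))⁻¹, ?_⟩⁻¹, hs, fun g h => by simp⟩
  simp [MonoidHom.mem_ker, hs]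

variable [IsMulCommutative r.ker]

theorem ker_mul_comm (k l : r.ker) : (k : A) * l = l * k :=
  congrArg Subtype.val (mul_comm k l)

variable (hρ : ∀ g, ρ g ∈ r.range) {s : G → A}

/-- Translates the additive cocycle condition of the module `kerRep` into an identity in `A`: since
`s g` lies over `ρ g`, the action of `g` is conjugation by `s g`. -/
theorem cochain_mem_cocycles₂_iff (hs : ∀ g, r (s g) = ρ g) (o : G → G → r.ker) :
    cochain r ρ hρ o ∈ cocycles₂ (kerRep r ρ hρ) ↔ ∀ g h j,
      (o (g * h) j * o g h : A) = s g * o h j * (s g)⁻¹ * o g (h * j) := by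
  rw [mem_cocycles₂_iff]
  refine forall_congr' fun g => forall_congr' fun h => forall_congr' fun j => ?_
  rw [show cochain r ρ hρ o (h, j) = (Additive.ofMul (o h j) : Additive r.ker) from rfl,
    kerRep_apply r ρ hρ (hs g)]
  exact (Subtype.ext_iff (a1 := o (g * h) j * o g h)
    (a2 := ⟨s g * o h j * (s g)⁻¹, r.normal_ker.conj_mem _ (o h j).2 _⟩ * o g (h * j)))

/-- The same translation for the differential of a 1-cochain, keeping the order of factors in which
`d₁₂` is written. -/
theorem cochain_sub_mem_coboundaries₂_iff (hs : ∀ g, r (s g) = ρ g) (o o' : G → G → r.ker) :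
    cochain r ρ hρ o - cochain r ρ hρ o' ∈ coboundaries₂ (kerRep r ρ hρ) ↔
      ∃ b : G → r.ker, ∀ g h,
        (s g * b h * (s g)⁻¹ * (b (g * h))⁻¹ * b g : A) = o g h * (o' g h)⁻¹ := by
  have key : ∀ (b : G → r.ker) (g h : G),
      d₁₂ (kerRep r ρ hρ) (fun x => (Additive.ofMul (b x) : Additive r.ker)) (g, h) =
        (cochain r ρ hρ o - cochain r ρ hρ o') (g, h) ↔
      (s g * b h * (s g)⁻¹ * (b (g * h))⁻¹ * b g : A) = o g h * (o' g h)⁻¹ := by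
    intro b g h
    change (kerRep r ρ hρ).ρ g (Additive.ofMul (b h) : Additive r.ker) - _ + _ = _ ↔ _
    rw [kerRep_apply r ρ hρ (hs g)]
    exact (Subtype.ext_iff
      (a1 := ⟨s g * b h * (s g)⁻¹, r.normal_ker.conj_mem _ (b h).2 _⟩ / b (g * h) * b g)
      (a2 := o g h / o' g h)).trans (iff_of_eq (by simp only [div_eq_mul_inv]; rfl))
  constructor
  · rintro ⟨b, hb⟩
    exact ⟨b, fun g h => (key b g h).1 (congrFun hb (g, h))⟩
  · rintro ⟨b, hb⟩
    exact ⟨_, funext fun p => (key b p.1 p.2).2 (hb p.1 p.2)⟩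

/-- Associativity in `A`: after expanding `o` in terms of `s`, both sides of the cocycle identity
telescope to the same word. -/
theorem IsLiftWithObstruction.mem_cocycles₂ {o : G → G → r.ker}
    (h : IsLiftWithObstruction r ρ s o) :
    cochain r ρ hρ o ∈ cocycles₂ (kerRep r ρ hρ) := by
  rw [cochain_mem_cocycles₂_iff hρ h.map_eq]
  intro g k j
  have e : ∀ x y, (o x y : A) = s (x * y) * (s y)⁻¹ * (s x)⁻¹ := fun x y => by
    rw [← _root_.inv_inj, ← Subgroup.coe_inv, h.inv_eq]
    group
  -- Since `o` is the inverse of the factor set, the right-hand side telescopes only with its two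
  -- factors exchanged; this is where commutativity of `ker r` enters.
  have hc := ker_mul_comm ⟨s g * o k j * (s g)⁻¹, r.normal_ker.conj_mem _ (o k j).2 _⟩
    (o g (k * j))
  simp only at hc
  rw [hc, e, e, e, e, mul_assoc g k j]
  group


/-- Moving `b k` to the left past `s g` turns it into its conjugate, so the new factor set is the
old one times the coboundary of `b`. Stating this as an equivalence serves both directions of
`represents_iff`. -/
theorem IsLiftWithObstruction.mul_iff {o : G → G → r.ker} (h : IsLiftWithObstruction r ρ s o)
    (o' : G → G → r.ker) (b : G → r.ker) :
    IsLiftWithObstruction r ρ (fun g => b g * s g) o' ↔ ∀ g k,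
      (s g * b k * (s g)⁻¹ * (b (g * k))⁻¹ * b g : A) = o g k * (o' g k)⁻¹ := by
  have hr : ∀ g, r (b g * s g) = ρ g := fun g => by
    rw [map_mul, (b g).2, one_mul, h.map_eq]
  have key : ∀ g k, ((o' g k)⁻¹ : r.ker) = b g * s g * (b k * s k) * (b (g * k) * s (g * k))⁻¹ ↔
      (s g * b k * (s g)⁻¹ * (b (g * k))⁻¹ * b g : A) = o g k * (o' g k)⁻¹ := by
    intro g k
    -- `x` is the result of `g` acting on `b k`. With it the factor set of `b * s` is a product
    -- inside `ker r`, where factors may be reordered freely.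
    let x : r.ker := ⟨s g * b k * (s g)⁻¹, r.normal_ker.conj_mem _ (b k).2 _⟩
    have e : (b g * s g * (b k * s k) * (b (g * k) * s (g * k))⁻¹ : A) =
        (b g * x * (o g k)⁻¹ * (b (g * k))⁻¹ : r.ker) := by
      simp only [Subgroup.coe_mul, h.inv_eq, Subgroup.coe_inv (H := r.ker) (b (g * k)), x]
      group
    rw [e]
    refine Subtype.ext_iff.symm.trans (Iff.trans ?_
      (Subtype.ext_iff (a1 := x * (b (g * k))⁻¹ * b g) (a2 := o g k * (o' g k)⁻¹)))
    rw [← inv_mul_eq_iff_eq_mul (a := o g k), eq_comm]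
    have hcomm : ∀ i j k l : r.ker, i * j * k * l = k * (j * l * i) := fun i j k l => by
      ac_rfl
    exact iff_of_eq (congrArg (· = (o' g k)⁻¹) (hcomm _ _ _ _))
  exact ⟨fun H g k => (key g k).1 (H.inv_eq g k), fun H => ⟨hr, fun g k => (key g k).2 (H g k)⟩⟩

/-- Given one lift of `ρ`, a cochain represents the obstruction class exactly if it comes from
some lift. -/
theorem IsLiftWithObstruction.represents_iff {o : G → G → r.ker}
    (h : IsLiftWithObstruction r ρ s o) {c : H2 (kerRep r ρ hρ)} (hc : Represents r ρ hρ o c)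
    (o' : G → G → r.ker) :
    Represents r ρ hρ o' c ↔ ∃ s', IsLiftWithObstruction r ρ s' o' := by
  obtain ⟨ho, rfl⟩ := hc
  constructor
  · rintro ⟨ho', e⟩
    -- Equality of classes provides a `b` whose coboundary is `o / o'`; the required lift is `b *
    -- s`.
    obtain ⟨b, hb⟩ := (cochain_sub_mem_coboundaries₂_iff hρ h.map_eq o o').1
      ((H2π_eq_iff ⟨_, ho⟩ ⟨_, ho'⟩).1 e.symm)
    exact ⟨_, (h.mul_iff o' b).2 hb⟩
  · rintro ⟨s', h'⟩
    refine ⟨h'.mem_cocycles₂ hρ, ((H2π_eq_iff ⟨_, ho⟩ ⟨_, h'.mem_cocycles₂ hρ⟩).2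
      ((cochain_sub_mem_coboundaries₂_iff hρ h.map_eq o o').2 ?_)).symm⟩
    -- The quotient of two lifts of `ρ` takes values in `ker r`, and its coboundary is `o / o'`.
    let b : G → r.ker := fun g => ⟨s' g * (s g)⁻¹, by
      rw [MonoidHom.mem_ker, map_mul, map_inv, h'.map_eq, h.map_eq, mul_inv_cancel]⟩
    have hb : (fun g => b g * s g) = s' := funext fun g => inv_mul_cancel_right _ _
    exact ⟨b, (h.mul_iff o' b).1 (hb ▸ h')⟩

theorem represents_one_iff {c : H2 (kerRep r ρ hρ)} :
    Represents r ρ hρ (fun _ _ => 1) c ↔ c = 0 := by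
  have h0 : cochain r ρ hρ (fun _ _ => 1) ∈ cocycles₂ (kerRep r ρ hρ) := Submodule.zero_mem _
  have h1 : H2π (kerRep r ρ hρ) ⟨_, h0⟩ = 0 :=
    (H2π_eq_zero_iff ⟨_, h0⟩).2 (Submodule.zero_mem (coboundaries₂ (kerRep r ρ hρ)))
  exact ⟨fun ⟨_, e⟩ => e.symm.trans h1, fun e => ⟨h0, h1.trans e.symm⟩⟩

omit [IsMulCommutative r.ker] in
theorem exists_isLiftWithObstruction_one_iff :
    (∃ s, IsLiftWithObstruction r ρ s fun _ _ => 1) ↔ ∃ s : G →* A, r.comp s = ρ := by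
  constructor
  · rintro ⟨s, h⟩
    refine ⟨MonoidHom.mk' s fun g k => ?_, MonoidHom.ext h.map_eq⟩
    have := h.inv_eq g k
    rw [inv_one, Subgroup.coe_one, eq_comm, mul_inv_eq_one] at this
    exact this.symm
  · rintro ⟨s, rfl⟩
    exact ⟨s, fun _ => rfl, fun g k => by simp⟩

end Lifts

/-! ### The pullback extension and homomorphisms out of central extensions -/

section Extensions
variable {A Q : Type} [Group A] [Group Q] (r : A →* Q)
variable {G : Type} [Group G] (ρ : G →* Q)

/-- The pullback along `ρ` of the extension of `r.range` by `r.ker`. -/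
def pullbackExtension (hρ : ∀ g, ρ g ∈ r.range) :
    GroupExtension r.ker ((r.comp (MonoidHom.fst A G)).eqLocus (ρ.comp (MonoidHom.snd A G))) G where
  inl := ((MonoidHom.inl A G).comp r.ker.subtype).codRestrict _ fun k =>
    (show r k = ρ 1 by rw [map_one]; exact k.2)
  rightHom := (MonoidHom.snd A G).comp (Subgroup.subtype _)
  inl_injective k l h := Subtype.ext (congrArg (fun x => x.1.1) h)
  range_inl_eq_ker_rightHom := by
    ext x
    rw [MonoidHom.mem_ker]
    constructor
    · rintro ⟨k, rfl⟩
      rfl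
    · intro hx
      have hx' : x.1.2 = 1 := hx
      have h : r x.1.1 = ρ x.1.2 := x.2
      refine ⟨⟨x.1.1, ?_⟩, Subtype.ext (Prod.ext rfl hx'.symm)⟩
      rw [MonoidHom.mem_ker, h, hx', map_one]
  rightHom_surjective g := by
    obtain ⟨a, ha⟩ := hρ g
    exact ⟨⟨(a, g), ha⟩, rfl⟩

variable {r ρ}

/-- Conjugation permutes the non-trivial elements of `H`, and there is only one. -/
theorem le_center_of_card_eq_two {A : Type*} [Group A] (H : Subgroup A) [H.Normal]
    (h : Nat.card H = 2) : H ≤ Subgroup.center A := by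
  obtain ⟨z, -, hz⟩ := (Nat.card_eq_two_iff' (1 : H)).1 h
  intro k hk
  rw [Subgroup.mem_center_iff]
  intro a
  by_cases hk1 : k = 1
  · simp [hk1]
  · have h1 := hz ⟨k, hk⟩ (by simpa [Subtype.ext_iff] using hk1)
    have h2 := hz ⟨a * k * a⁻¹, ‹H.Normal›.conj_mem k hk a⟩ (by simpa [Subtype.ext_iff] using hk1)
    exact mul_inv_eq_iff_eq_mul.1 (congrArg Subtype.val (h2.trans h1.symm))

theorem inv_eq_self_of_card_eq_two {K : Type*} [Group K] (h : Nat.card K = 2) (k : K) :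
    k⁻¹ = k := by
  rw [inv_eq_iff_mul_eq_one, ← sq, ← h, pow_card_eq_one']

/-- A lift of `ρ` with the factor set of a section of a central extension extends to a
homomorphism that is the identity on the kernel. -/
theorem exists_monoidHom_of_factorSet_eq {G' : Type} [Group G'] (S : GroupExtension r.ker G' G)
    (hS : S.inl.range ≤ Subgroup.center G') (hr : r.ker ≤ Subgroup.center A)
    (t : S.Section) {s : G → A} (hs : ∀ g, r (s g) = ρ g) {z : G → G → r.ker}
    (ht : ∀ g h, S.inl (z g h) = t.toFun g * t.toFun h * (t.toFun (g * h))⁻¹)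
    (hz : ∀ g h, (z g h : A) = s g * s h * (s (g * h))⁻¹) :
    ∃ f : G' →* A, r.comp f = ρ.comp S.rightHom ∧ ∀ k : r.ker, f (S.inl k) = k := by
  -- Normal form: each `x` is `S.inl (κ x)` times the section value over its image in `G`.
  have hk : ∀ x : G', ∃ k, S.inl k = x * (t (S.rightHom x))⁻¹ := fun x => by
    change _ ∈ S.inl.range
    rw [S.range_inl_eq_ker_rightHom, MonoidHom.mem_ker, map_mul, map_inv, t.rightHom_section,
      mul_inv_cancel]
  choose κ hκ using hk
  have hκ' : ∀ x, x = S.inl (κ x) * t (S.rightHom x) := fun x => by rw [hκ]; group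
  have ht' : ∀ g h, t g * t h = S.inl (z g h) * t (g * h) := fun g h => by
    rw [ht]
    exact (inv_mul_cancel_right _ _).symm
  have hz' : ∀ g h, s g * s h = z g h * s (g * h) := fun g h => by rw [hz]; group
  -- Centrality of `S.inl.range` lets `κ y` pass the section value of `x`; the two section values
  -- then multiply with the factor `z`.
  have hmul : ∀ x y, κ (x * y) = κ x * κ y * z (S.rightHom x) (S.rightHom y) := fun x y => by
    apply S.inl_injective
    rw [hκ, map_mul, mul_inv_eq_iff_eq_mul, map_mul, map_mul, mul_assoc _ (S.inl (z _ _)), ← ht']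
    have hc := Subgroup.mem_center_iff.1 (hS ⟨κ y, rfl⟩) (t (S.rightHom x))
    conv_lhs => rw [hκ' x, hκ' y]
    rw [mul_assoc, ← mul_assoc (t _), hc]
    simp only [mul_assoc]
  -- Neither `t` nor `s` is normalized at `1`. Both defects are measured by `z 1 1`, which maps to
  -- `t 1` and equals `s 1`, so they cancel.
  have h1 : (κ 1 * s 1 : A) = 1 := by
    have e1 : κ 1 = (z 1 1)⁻¹ := by
      apply S.inl_injective
      rw [hκ, map_inv, ht, map_one]
      simp only [mul_one, mul_inv_cancel_right, one_mul]
      rfl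
    rw [e1, Subgroup.coe_inv, hz]
    simp
  refine ⟨MonoidHom.mk' (fun x => κ x * s (S.rightHom x)) fun x y => ?_, ?_, fun k => ?_⟩
  · have hc := Subgroup.mem_center_iff.1 (hr (κ y).2) (s (S.rightHom x))
    rw [mul_assoc, ← mul_assoc (s _), hc, hmul, map_mul, Subgroup.coe_mul, Subgroup.coe_mul,
      mul_assoc _ (z _ _ : A), ← hz']
    simp only [mul_assoc]
  · ext x
    change r (κ x * s (S.rightHom x)) = ρ (S.rightHom x)
    rw [map_mul, (κ x).2, one_mul, hs]
  · change (κ (S.inl k) * s (S.rightHom (S.inl k)) : A) = k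
    have e : κ (S.inl k) = k * κ 1 := by
      apply S.inl_injective
      rw [map_mul, hκ, hκ, S.rightHom_inl, map_one S.rightHom, one_mul]
    rw [e, S.rightHom_inl, Subgroup.coe_mul, mul_assoc, h1, mul_one]

/-- The pullback extension is classified by the cochains of lifts of `ρ`, if `ker r` has
two elements. -/
theorem pullbackExtension_isCentralExtensionClassifiedBy [IsMulCommutative r.ker]
    (hρ : ∀ g, ρ g ∈ r.range) (h2 : Nat.card r.ker = 2) {s : G → A} {o : G → G → r.ker}
    (h : IsLiftWithObstruction r ρ s o) {c : H2 (kerRep r ρ hρ)} (hc : Represents r ρ hρ o c) :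
    IsCentralExtensionClassifiedBy r ρ hρ (pullbackExtension r ρ hρ) c := by
  refine ⟨?_, ⟨fun g => ⟨(s g, g), h.map_eq g⟩, fun _ => rfl⟩, o, fun g k => ?_, hc⟩
  · rintro _ ⟨k, rfl⟩
    rw [Subgroup.mem_center_iff]
    intro x
    refine Subtype.ext (Prod.ext ?_ ?_)
    · exact Subgroup.mem_center_iff.1 (le_center_of_card_eq_two r.ker h2 k.2) x.1.1
    · exact (mul_one x.1.2).trans (one_mul x.1.2).symm
  · refine Subtype.ext (Prod.ext ?_ ?_)
    · exact (congrArg Subtype.val (inv_eq_self_of_card_eq_two h2 (o g k))).symm.trans (h.inv_eq g k)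
    · exact (mul_inv_cancel (g * k)).symm

end Extensions
end KernelLift

/-! ### Application to the restriction map of a minimal modular extension -/

theorem mainTheorem6 (C : SuperModularCategory) (D : SpinModularCategory)
    (E : MinimalModularExtension C D) {G : Type} [Group G]
    (ρ : G →* UBFC.AutLR C.toUBFC C.psi) (hρ : ∀ g, ρ g ∈ E.restrict.range)
    [IsMulCommutative E.restrict.ker] :
    ∃ c : groupCohomology.H2 (KernelLift.kerRep E.restrict ρ hρ),
      -- every choice of lifts gives a cocycle with values in `ker r`, of class `c`
      (∀ s : G → UBFC.AutLR D.toUBFC D.psi, (∀ g, E.restrict (s g) = ρ g) →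
        ∃ o : G → G → E.restrict.ker,
          (∀ g h, ((o g h)⁻¹ : E.restrict.ker) = s g * s h * (s (g * h))⁻¹) ∧
          KernelLift.Represents E.restrict ρ hρ o c) ∧
      -- the lifts can be chosen to form a homomorphism iff `c = 0`
      ((∃ s : G →* UBFC.AutLR D.toUBFC D.psi, E.restrict.comp s = ρ) ↔ c = 0) ∧
      -- if `ker r` has two elements, the symmetry lifts to the central extension classified by `c`
      (Nat.card E.restrict.ker = 2 →
        E.restrict.ker ≤ Subgroup.center (UBFC.AutLR D.toUBFC D.psi) ∧
        (∃ (G' : Type) (_ : Group G') (S : GroupExtension E.restrict.ker G' G),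
          KernelLift.IsCentralExtensionClassifiedBy E.restrict ρ hρ S c) ∧
        ∀ (G' : Type) [Group G'] (S : GroupExtension E.restrict.ker G' G),
          KernelLift.IsCentralExtensionClassifiedBy E.restrict ρ hρ S c →
          ∃ s : G' →* UBFC.AutLR D.toUBFC D.psi,
            E.restrict.comp s = ρ.comp S.rightHom ∧
            ∀ k : E.restrict.ker, s (S.inl k) = k) := by
  choose s hs using id hρ
  obtain ⟨o, ho⟩ := KernelLift.exists_isLiftWithObstruction hs
  -- The class is defined by one arbitrary lift; `represents_iff` then compares every other cochain
  -- with it.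
  obtain ⟨c, hc⟩ : ∃ c, KernelLift.Represents E.restrict ρ hρ o c :=
    ⟨_, ho.mem_cocycles₂ hρ, rfl⟩
  refine ⟨c, fun s' hs' => ?_, ?_, fun h2 => ⟨?_, ?_, ?_⟩⟩
  · obtain ⟨o', ho'⟩ := KernelLift.exists_isLiftWithObstruction hs'
    exact ⟨o', ho'.inv_eq, (ho.represents_iff hρ hc o').2 ⟨s', ho'⟩⟩
  · rw [← KernelLift.exists_isLiftWithObstruction_one_iff, ← KernelLift.represents_one_iff hρ]
    exact (ho.represents_iff hρ hc _).symm
  · exact KernelLift.le_center_of_card_eq_two _ h2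
  · exact ⟨_, _, _, KernelLift.pullbackExtension_isCentralExtensionClassifiedBy hρ h2 ho hc⟩
  · rintro G' _ S ⟨hS, t, z, ht, hz⟩
    -- The lift is adapted to the given section: its obstruction cochain is `z` on the nose, not
    -- merely up to a coboundary.
    obtain ⟨s', hs'⟩ := (ho.represents_iff hρ hc z).1 hz
    refine KernelLift.exists_monoidHom_of_factorSet_eq S hS
      (KernelLift.le_center_of_card_eq_two _ h2) t hs'.map_eq ht fun g h => ?_
    rw [← hs'.inv_eq, KernelLift.inv_eq_self_of_card_eq_two h2]
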